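/- There is an absolute constant $C$ with the following property. Let $G=(V,E,\omega)$ be a finite simple undirected graph with edge weights $\omega:E\to[0,\infty]$, given with a planar embedding: vertices are mapped to distinct points of the plane and every edge to a simple arc joining the points of its two end vertices, such that an arc contains no points of vertices other than its two ends and two distinct arcs meet only in points of common end vertices. Let $\mathrm{dist}_G(u,v)$ be the minimum total weight of a path from $u$ to $v$ ($\infty$ if there is no path). Fix a linear order on $V$, let $\emptyset\ne S\subseteq V$, and for $v\in V$ let $\arg\min_{s\in S}\mathrm{dist}_G(s,v)$ denote the element of $S$ at minimum distance to $v$, the smallest one in the linear order in case of a tie. Let $p=p_1,\dots,p_k$ be a shortest path of $G$ of finite weight (a simple path whose weight equals $\mathrm{dist}_G(p_1,p_k)<\infty$) whose vertices and edges are all contained in the boundary of one face of $G$, a face being a connected component of the complement of the embedded graph in the plane. Let $M(i)=\arg\min_{s\in S}\mathrm{dist}_G(s,p_i)$ for $1\le i\le k$ be the label sequence of $p$ with respect to $S$. Then its alternation number $$|M|=\#\{\,1\le i<k : M(i)\ne M(i+1)\,\}$$ satisfies $|M|\le C\,|S|$; that is, $|M|=O(|S|)$, independently of $G$ and of the length of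 $p$. -/

import Mathlib

open scoped ENNReal

/-! ### Weighted distances and label sequences -/

section Labels

variable {V : Type*} {G : SimpleGraph V}

/-- The weight of a walk: the sum of the weights of its edges, with multiplicity. Only the values
of `ω` on edges of the graph matter. -/
def walkWeight (ω : Sym2 V → ℝ≥0∞) {u v : V} (p : G.Walk u v) : ℝ≥0∞ :=
  (p.edges.map ω).sum

/-- The weighted distance: the minimum weight of a walk from `u` to `v` (and `∞` if there is none).
As weights are nonnegative, this is the weight of a shortest path. -/
noncomputable def weightedDist (G : SimpleGraph V) (ω : Sym2 V → ℝ≥0∞) (u v : V) : ℝ≥0∞ :=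
  ⨅ p : G.Walk u v, walkWeight ω p

/-- A shortest path: a simple path whose weight is the distance between its end vertices. -/
def IsShortestPath (ω : Sym2 V → ℝ≥0∞) {u v : V} (p : G.Walk u v) : Prop :=
  p.IsPath ∧ walkWeight ω p = weightedDist G ω u v

/-- The elements of `S` at minimum distance to `v`. -/
noncomputable def nearestSites (G : SimpleGraph V) (ω : Sym2 V → ℝ≥0∞) (S : Finset V) (v : V) :
    Finset V :=
  S.filter fun s => ∀ t ∈ S, weightedDist G ω s v ≤ weightedDist G ω t v

theorem nearestSites_nonempty (G : SimpleGraph V) (ω : Sym2 V → ℝ≥0∞) (S : Finset V)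
    (hS : S.Nonempty) (v : V) : (nearestSites G ω S v).Nonempty := by
  obtain ⟨s, hs, hmin⟩ := S.exists_min_image (fun s => weightedDist G ω s v) hS
  exact ⟨s, Finset.mem_filter.2 ⟨hs, hmin⟩⟩

/-- `arg min_{s ∈ S} dist(s, v)`, ties being broken by the linear order on the vertices. -/
noncomputable def nearestSite [LinearOrder V] (G : SimpleGraph V) (ω : Sym2 V → ℝ≥0∞)
    (S : Finset V) (hS : S.Nonempty) (v : V) : V :=
  (nearestSites G ω S v).min' (nearestSites_nonempty G ω S hS v)

/-- The label sequence of a sequence `p` of vertices with respect to `S`. -/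
noncomputable def labelSequence [LinearOrder V] (G : SimpleGraph V) (ω : Sym2 V → ℝ≥0∞)
    (S : Finset V) (hS : S.Nonempty) (p : List V) : List V :=
  p.map (nearestSite G ω S hS)

/-- The number of indices at which two consecutive entries of a sequence differ. -/
def alternationNumber {α : Type*} [DecidableEq α] (M : List α) : ℕ :=
  ∑ i ∈ Finset.range (M.length - 1), if M[i]? ≠ M[i + 1]? then 1 else 0

end Labels

/-! ### Planar embeddings -/

/-- The Euclidean plane. -/
abbrev Plane : Type := EuclideanSpace ℝ (Fin 2)

/-- `A` is a simple arc with endpoints `x` and `y`. -/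
def IsSimpleArc (A : Set Plane) (x y : Plane) : Prop :=
  ∃ γ : Path x y, Function.Injective γ ∧ Set.range γ = A

/-- A planar embedding: vertices are distinct points, edges are simple arcs between the points of
their ends, and two arcs meet only in points of common end vertices. The values of `arc` outside
the edge set play no role. -/
structure PlanarEmbedding {V : Type*} (G : SimpleGraph V) where
  point : V → Plane
  arc : Sym2 V → Set Plane
  point_injective : Function.Injective point
  isSimpleArc : ∀ u v, G.Adj u v → IsSimpleArc (arc s(u, v)) (point u) (point v)
  mem_of_point_mem_arc : ∀ v, ∀ e ∈ G.edgeSet, point v ∈ arc e → v ∈ e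
  arc_inter_arc : ∀ e ∈ G.edgeSet, ∀ e' ∈ G.edgeSet, e ≠ e' →
    ∀ x, x ∈ arc e → x ∈ arc e' → ∃ v, v ∈ e ∧ v ∈ e' ∧ x = point v

namespace PlanarEmbedding

variable {V : Type*} {G : SimpleGraph V}

/-- The subset of the plane covered by the embedded graph. -/
def drawing (Φ : PlanarEmbedding G) : Set Plane :=
  Set.range Φ.point ∪ ⋃ e ∈ G.edgeSet, Φ.arc e

/-- A face: a connected component of the complement of the embedded graph. -/
def IsFace (Φ : PlanarEmbedding G) (f : Set Plane) : Prop :=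
  ∃ x ∈ Φ.drawingᶜ, f = connectedComponentIn Φ.drawingᶜ x

/-- The subset of the plane covered by a walk: the points of its vertices and the arcs of its
edges. -/
def walkImage (Φ : PlanarEmbedding G) {u v : V} (p : G.Walk u v) : Set Plane :=
  Φ.point '' {w | w ∈ p.support} ∪ ⋃ e ∈ p.edges, Φ.arc e

end PlanarEmbedding

/-!
The constant is `2`. Call the vertices labelled `s` the cell of `s`; it is connected, because a
shortest path from `s` to a vertex of its cell stays in the cell (`exists_walk_in_cell`).

If a change of label from `i` to `i + 1` neither leads to a label occurring for the first time nor
leaves a label occurring for the last time, then the labels read `s, …, t, s, …, t` along the path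
(`card_changes_le_of_first_or_last`). There are at most `2 |S|` other changes, so it suffices to
exclude this pattern (`labels_not_alternating`). It provides three edges of the path between the
cell of `s` and its complement, all of whose outer ends are connected to `t` outside the cell. As
these edges lie on the frontier of one face, a point of the face can be joined through the face to
an inner point of each of the three arcs. Together with `s` and `t` this draws the complete
bipartite graph on 3 + 3 vertices in the plane (`PlanarEmbedding.not_three_edges_on_face`).

The non-planarity of that graph is proved for arbitrary continuous curves, without the Jordan curve
theorem (`no_planar_K33`). For disjoint curves `γ` and `δ` the function `γ s - δ t` has a
continuous logarithm on the unit square, so its changes along the four sides cancel. Each side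
records how the direction from a vertex to the points of an edge not containing it turns, which is
determined by the end points up to a multiple of `2 π i`. This gives one relation between integers
for each of the 18 pairs of independent edges. Modulo 2 the left sides of these relations add up
to zero, since every vertex and edge occur together in two of them, while the right sides add up
to 9, the number of crossings in a drawing with straight edges and the two sides on parallel lines.
-/

/-! ### The complete bipartite graph on 3 + 3 vertices does not embed in the plane -/

/-- A nowhere vanishing continuous function on a simply connected space has a continuous
logarithm. -/
theorem exists_continuous_exp_eq {A : Type*} [TopologicalSpace A] [SimplyConnectedSpace A]
    [LocallyPathConnectedSpace A] {f : A → ℂ} (hf : Continuous f) (h0 : ∀ x, f x ≠ 0) :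
    ∃ g : A → ℂ, Continuous g ∧ ∀ x, Complex.exp (g x) = f x := by
  obtain ⟨x₀⟩ : Nonempty A := inferInstance
  obtain ⟨g, ⟨-, hg⟩, -⟩ := Complex.isCoveringMapOn_exp.existsUnique_continuousMap_lifts
    (⟨f, hf⟩ : C(A, ℂ)) (a₀ := x₀) (Complex.exp_log (h0 x₀)) h0
  exact ⟨g, g.continuous, fun x => congrFun hg x⟩

/-- Two continuous logarithms of the same function differ by a constant. -/
theorem sub_eq_sub_of_exp_eq {A : Type*} [TopologicalSpace A] [SimplyConnectedSpace A]
    [LocallyPathConnectedSpace A] {g g' : A → ℂ} (hg : Continuous g) (hg' : Continuous g')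
    (h : ∀ x, Complex.exp (g x) = Complex.exp (g' x)) (x y : A) :
    g y - g x = g' y - g' x := by
  have key := (Complex.isCoveringMapOn_exp.existsUnique_continuousMap_lifts
    (⟨fun z => Complex.exp (g z), by fun_prop⟩ : C(A, ℂ)) (a₀ := x) (e₀ := g x) rfl
    (fun z => Complex.exp_ne_zero _)).unique
    (y₁ := ⟨g, hg⟩) (y₂ := ⟨fun z => g' z + (g x - g' x), by fun_prop⟩) ⟨rfl, rfl⟩
    ⟨by simp, by
      funext z
      simp [Complex.exp_add, Complex.exp_sub, h, Complex.exp_ne_zero]⟩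
  have hy := congrArg (fun F : C(A, ℂ) => F y) key
  simp only [ContinuousMap.coe_mk] at hy
  rw [hy]
  ring

/-- If two curves `γ` and `δ` are disjoint, then `γ s - δ t` has a logarithm on the whole square,
so the four changes of the logarithm along the sides of the square add up to zero. -/
theorem log_change_around_square {γ δ : ℝ → ℂ} (hγ : Continuous γ) (hδ : Continuous δ)
    (hne : ∀ s t, γ s ≠ δ t) {x y x' y' : ℝ → ℂ}
    (hx : Continuous x) (hy : Continuous y) (hx' : Continuous x') (hy' : Continuous y')
    (ex : ∀ s, Complex.exp (x s) = γ s - δ 0) (ey : ∀ s, Complex.exp (y s) = γ s - δ 1)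
    (ex' : ∀ t, Complex.exp (x' t) = δ t - γ 0) (ey' : ∀ t, Complex.exp (y' t) = δ t - γ 1) :
    (x 1 - x 0) + (y' 1 - y' 0) = (x' 1 - x' 0) + (y 1 - y 0) := by
  obtain ⟨g, hg, eg⟩ := exists_continuous_exp_eq (A := ℝ × ℝ) (f := fun q => γ q.1 - δ q.2)
    (by fun_prop) (fun q => sub_ne_zero.2 (hne _ _))
  have hpi : ∀ z : ℂ, Complex.exp (z + Real.pi * Complex.I) = -Complex.exp z := by
    intro z; rw [Complex.exp_add, Complex.exp_pi_mul_I]; ring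
  have h1 := sub_eq_sub_of_exp_eq hx (g' := fun s => g (s, 0)) (by fun_prop)
    (fun s => by rw [ex, eg]) 0 1
  have h2 := sub_eq_sub_of_exp_eq hy (g' := fun s => g (s, 1)) (by fun_prop)
    (fun s => by rw [ey, eg]) 0 1
  have h3 := sub_eq_sub_of_exp_eq hx' (g' := fun t => g (0, t) + Real.pi * Complex.I)
    (by fun_prop) (fun t => by rw [ex', hpi, eg]; ring) 0 1
  have h4 := sub_eq_sub_of_exp_eq hy' (g' := fun t => g (1, t) + Real.pi * Complex.I)
    (by fun_prop) (fun t => by rw [ey', hpi, eg]; ring) 0 1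
  rw [h1, h2, h3, h4]
  ring

/-- A logarithm of the antisymmetric function `a i - a k`, normalised so that exchanging the
indices changes it by exactly `π i`. -/
theorem exists_antisymm_log (a : Fin 3 → ℂ) (ha : ∀ i k, i ≠ k → a i ≠ a k) :
    ∃ A : Fin 3 → Fin 3 → ℂ, (∀ i k, i ≠ k → Complex.exp (A i k) = a i - a k) ∧
      ∀ i k, i < k → A k i = A i k + Real.pi * Complex.I := by
  refine ⟨fun i k => if i < k then Complex.log (a i - a k)
    else Complex.log (a k - a i) + Real.pi * Complex.I, fun i k hik => ?_, fun i k hik => ?_⟩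
  · dsimp only
    split_ifs
    · exact Complex.exp_log (sub_ne_zero.2 (ha i k hik))
    · rw [Complex.exp_add, Complex.exp_pi_mul_I,
        Complex.exp_log (sub_ne_zero.2 (ha k i hik.symm))]
      ring
  · simp [hik, hik.le.not_gt]

/-- The parity contradiction behind the non-planarity of the complete bipartite graph: every
integer occurs in exactly two of the relations, while the number of relations with an odd
constant is nine. -/
theorem no_crossing_parity (x y : Fin 3 → Fin 3 → Fin 3 → ℤ)
    (hlt : ∀ i k j l, i < k → j < l → x k i j + y j k l - x i k l - y l i j = -1)
    (hgt : ∀ i k j l, i < k → l < j → x k i j + y j k l - x i k l - y l i j = 0) : False := by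
  have h01 : (0 : Fin 3) < 1 := by decide
  have h02 : (0 : Fin 3) < 2 := by decide
  have h12 : (1 : Fin 3) < 2 := by decide
  have a1 := hlt _ _ _ _ h01 h01
  have a2 := hlt _ _ _ _ h01 h02
  have a3 := hlt _ _ _ _ h01 h12
  have a4 := hlt _ _ _ _ h02 h01
  have a5 := hlt _ _ _ _ h02 h02
  have a6 := hlt _ _ _ _ h02 h12
  have a7 := hlt _ _ _ _ h12 h01
  have a8 := hlt _ _ _ _ h12 h02
  have a9 := hlt _ _ _ _ h12 h12
  have b1 := hgt _ _ _ _ h01 h01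
  have b2 := hgt _ _ _ _ h01 h02
  have b3 := hgt _ _ _ _ h01 h12
  have b4 := hgt _ _ _ _ h02 h01
  have b5 := hgt _ _ _ _ h02 h02
  have b6 := hgt _ _ _ _ h02 h12
  have b7 := hgt _ _ _ _ h12 h01
  have b8 := hgt _ _ _ _ h12 h02
  have b9 := hgt _ _ _ _ h12 h12
  omega

/-- The complete bipartite graph on 3 + 3 vertices cannot be drawn in the plane with independent
edges disjoint. Edges with a common end may meet in any way. -/
theorem no_planar_K33 (a b : Fin 3 → ℂ) (γ : Fin 3 → Fin 3 → ℝ → ℂ)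
    (hc : ∀ i j, Continuous (γ i j)) (h0 : ∀ i j, γ i j 0 = a i) (h1 : ∀ i j, γ i j 1 = b j)
    (hd : ∀ i j k l, i ≠ k → j ≠ l → ∀ s t, γ i j s ≠ γ k l t) : False := by
  have hex : ∀ i : Fin 3, ∃ j, i ≠ j := by decide
  have hγa : ∀ k i j t, i ≠ k → γ i j t ≠ a k := fun k i j t hik => by
    obtain ⟨l, hl⟩ := hex j
    rw [← h0 k l]
    exact hd i j k l hik hl t 0
  have hγb : ∀ l i j t, j ≠ l → γ i j t ≠ b l := fun l i j t hjl => by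
    obtain ⟨k, hk⟩ := hex i
    rw [← h1 k l]
    exact hd i j k l hk hjl t 1
  have hX : ∀ k i j, ∃ g : ℝ → ℂ, i ≠ k →
      Continuous g ∧ ∀ t, Complex.exp (g t) = γ i j t - a k := fun k i j => by
    by_cases hik : i = k
    · exact ⟨0, fun h => absurd hik h⟩
    · obtain ⟨g, hg⟩ := exists_continuous_exp_eq ((hc i j).sub continuous_const)
        (fun t => sub_ne_zero.2 (hγa k i j t hik))
      exact ⟨g, fun _ => hg⟩
  have hY : ∀ l i j, ∃ g : ℝ → ℂ, j ≠ l →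
      Continuous g ∧ ∀ t, Complex.exp (g t) = γ i j t - b l := fun l i j => by
    by_cases hjl : j = l
    · exact ⟨0, fun h => absurd hjl h⟩
    · obtain ⟨g, hg⟩ := exists_continuous_exp_eq ((hc i j).sub continuous_const)
        (fun t => sub_ne_zero.2 (hγb l i j t hjl))
      exact ⟨g, fun _ => hg⟩
  choose X hX using hX
  choose Y hY using hY
  obtain ⟨A, hA, hA'⟩ := exists_antisymm_log a fun i k hik => by
    rw [← h0 i 0]; exact hγa k i 0 0 hik
  obtain ⟨D, hD, hD'⟩ := exists_antisymm_log b fun j l hjl => by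
    rw [← h1 0 j]; exact hγb l 0 j 1 hjl
  have hE : ∀ i j, ∃ e : ℂ, Complex.exp e = b j - a i := fun i j => by
    obtain ⟨k, hk⟩ := hex i
    exact ⟨_, Complex.exp_log (sub_ne_zero.2 (by rw [← h1 k j]; exact hγa i k j 1 hk.symm))⟩
  choose E hE using hE
  -- The change of each logarithm is prescribed by its end values, up to a multiple of `2 π i`.
  have hx : ∀ k i j, ∃ n : ℤ, i ≠ k →
      X k i j 1 - X k i j 0 = E k j - A i k + n * (2 * Real.pi * Complex.I) := fun k i j => by
    by_cases hik : i = k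
    · exact ⟨0, fun h => absurd hik h⟩
    · obtain ⟨n, hn⟩ := Complex.exp_eq_exp_iff_exists_int.1
        (show Complex.exp (X k i j 1 - X k i j 0) = Complex.exp (E k j - A i k) by
          rw [Complex.exp_sub, Complex.exp_sub, (hX k i j hik).2, (hX k i j hik).2, hE,
            hA i k hik, h0, h1])
      exact ⟨n, fun _ => hn⟩
  have hy : ∀ l i j, ∃ n : ℤ, j ≠ l → Y l i j 1 - Y l i j 0
      = D j l - (E i l + Real.pi * Complex.I) + n * (2 * Real.pi * Complex.I) := fun l i j => by
    by_cases hjl : j = l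
    · exact ⟨0, fun h => absurd hjl h⟩
    · obtain ⟨n, hn⟩ := Complex.exp_eq_exp_iff_exists_int.1
        (show Complex.exp (Y l i j 1 - Y l i j 0)
            = Complex.exp (D j l - (E i l + Real.pi * Complex.I)) by
          rw [Complex.exp_sub, Complex.exp_sub, Complex.exp_add, Complex.exp_pi_mul_I,
            (hY l i j hjl).2, (hY l i j hjl).2, hE, hD j l hjl, h0, h1]
          ring)
      exact ⟨n, fun _ => hn⟩
  choose x hx using hx
  choose y hy using hy
  have rel : ∀ i j k l, i ≠ k → j ≠ l →
      (X k i j 1 - X k i j 0) + (Y j k l 1 - Y j k l 0)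
        = (X i k l 1 - X i k l 0) + (Y l i j 1 - Y l i j 0) := fun i j k l hik hjl =>
    log_change_around_square (hc i j) (hc k l) (hd i j k l hik hjl)
      (hX k i j hik).1 (hY l i j hjl).1 (hX i k l hik.symm).1 (hY j k l hjl.symm).1
      (by rw [h0]; exact (hX k i j hik).2) (by rw [h1]; exact (hY l i j hjl).2)
      (by rw [h0]; exact (hX i k l hik.symm).2) (by rw [h1]; exact (hY j k l hjl.symm).2)
  have hpi : (Real.pi : ℂ) * Complex.I ≠ 0 :=
    mul_ne_zero (by exact_mod_cast Real.pi_ne_zero) Complex.I_ne_zero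
  refine no_crossing_parity x y (fun i k j l hik hjl => ?_) (fun i k j l hik hjl => ?_)
  · have h := rel i j k l hik.ne hjl.ne
    rw [hx k i j hik.ne, hy j k l hjl.ne', hx i k l hik.ne', hy l i j hjl.ne, hA' i k hik,
      hD' j l hjl] at h
    have h' : (Real.pi : ℂ) * Complex.I *
        (2 * ((x k i j : ℂ) + y j k l - x i k l - y l i j + 1)) = 0 := by
      linear_combination h
    have h2 := (mul_eq_zero.1 h').resolve_left hpi
    have h3 : 2 * (x k i j + y j k l - x i k l - y l i j + 1) = 0 := by exact_mod_cast h2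
    omega
  · have h := rel i j k l hik.ne hjl.ne'
    rw [hx k i j hik.ne, hy j k l hjl.ne, hx i k l hik.ne', hy l i j hjl.ne', hA' i k hik,
      hD' l j hjl] at h
    have h' : (Real.pi : ℂ) * Complex.I *
        (2 * ((x k i j : ℂ) + y j k l - x i k l - y l i j)) = 0 := by
      linear_combination h
    have h2 := (mul_eq_zero.1 h').resolve_left hpi
    have h3 : 2 * (x k i j + y j k l - x i k l - y l i j) = 0 := by exact_mod_cast h2
    omega

/-- `no_planar_K33` for nine curves in the plane, each confined to a given set. -/
theorem no_planar_K33_of_joinedIn (a b : Fin 3 → Plane) (F : Fin 3 → Fin 3 → Set Plane)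
    (hF : ∀ i j, JoinedIn (F i j) (a i) (b j))
    (hd : ∀ i j k l, i ≠ k → j ≠ l → Disjoint (F i j) (F k l)) : False := by
  choose γ hγ using hF
  let φ : Plane → ℂ := fun z => ⟨z 0, z 1⟩
  have hφ : Continuous φ := by
    have : φ = fun z => (z 0 : ℂ) + (z 1 : ℂ) * Complex.I := by
      funext z; apply Complex.ext <;> simp [φ]
    rw [this]; fun_prop
  have hinj : Function.Injective φ := by
    intro z w h
    have h0 := congrArg Complex.re h
    have h1 := congrArg Complex.im h
    ext i
    fin_cases i
    · exact h0
    · exact h1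
  refine no_planar_K33 (fun i => φ (a i)) (fun j => φ (b j)) (fun i j t => φ ((γ i j).extend t))
    (fun i j => hφ.comp (γ i j).continuous_extend) (fun i j => by simp) (fun i j => by simp) ?_
  intro i j k l hik hjl s t h
  have hmem : ∀ i j t, (γ i j).extend t ∈ F i j := fun i j t => by
    obtain ⟨u, hu⟩ : (γ i j).extend t ∈ Set.range (γ i j) := by
      rw [← Path.extend_range]; exact ⟨t, rfl⟩
    rw [← hu]; exact hγ i j u
  have h' : (γ i j).extend s = (γ k l).extend t := hinj h
  exact Set.disjoint_left.1 (hd i j k l hik hjl) (hmem i j s) (h' ▸ hmem k l t)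

/-! ### Curves inside a planar drawing -/

namespace PlanarEmbedding

variable {V : Type*} {G : SimpleGraph V} (Φ : PlanarEmbedding G)

/-- The part of a drawing spanned by a set `W` of vertices and a set `E` of edges: the points of
`W` and the arcs of `E` without any vertex points, so that an edge of `E` does not contribute its
ends. -/
def trace (W : Set V) (E : Set (Sym2 V)) : Set Plane :=
  Φ.point '' W ∪ ⋃ e ∈ E, Φ.arc e \ Set.range Φ.point

variable {Φ} {W W' : Set V} {E E' : Set (Sym2 V)} {u v : V}

theorem disjoint_trace (hE : E ⊆ G.edgeSet) (hE' : E' ⊆ G.edgeSet) (hW : Disjoint W W')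
    (hEE : Disjoint E E') : Disjoint (Φ.trace W E) (Φ.trace W' E') := by
  rw [Set.disjoint_left]
  rintro x (⟨w, hw, rfl⟩ | hx) (⟨w', hw', h⟩ | hx')
  · exact Set.disjoint_left.1 hW hw (Φ.point_injective h ▸ hw')
  · obtain ⟨e, -, -, he⟩ := Set.mem_iUnion₂.1 hx'
    exact he ⟨w, rfl⟩
  · obtain ⟨e, -, -, he⟩ := Set.mem_iUnion₂.1 hx
    exact he ⟨w', h⟩
  · obtain ⟨e, he, hxe, hxp⟩ := Set.mem_iUnion₂.1 hx
    obtain ⟨e', he', hxe', -⟩ := Set.mem_iUnion₂.1 hx'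
    obtain ⟨w, -, -, hw⟩ := Φ.arc_inter_arc e (hE he) e' (hE' he')
      (fun h => Set.disjoint_left.1 hEE he (h ▸ he')) x hxe hxe'
    exact hxp ⟨w, hw.symm⟩

theorem trace_subset_drawing (hE : E ⊆ G.edgeSet) : Φ.trace W E ⊆ Φ.drawing := by
  rintro x (⟨w, -, rfl⟩ | hx)
  · exact Or.inl ⟨w, rfl⟩
  · obtain ⟨e, he, hxe, -⟩ := Set.mem_iUnion₂.1 hx
    exact Or.inr (Set.mem_iUnion₂.2 ⟨e, hE he, hxe⟩)

theorem point_mem_trace (hu : u ∈ W) : Φ.point u ∈ Φ.trace W E := Or.inl ⟨u, hu, rfl⟩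

theorem mem_trace_of_mem_arc {e : Sym2 V} (he : e ∈ E) {x : Plane} (hx : x ∈ Φ.arc e)
    (hp : x ∉ Set.range Φ.point) : x ∈ Φ.trace W E :=
  Or.inr (Set.mem_iUnion₂.2 ⟨e, he, hx, hp⟩)

theorem joinedIn_trace_of_adj (h : G.Adj u v) (hu : u ∈ W) (hv : v ∈ W) (he : s(u, v) ∈ E) :
    JoinedIn (Φ.trace W E) (Φ.point u) (Φ.point v) := by
  obtain ⟨γ, -, hγ⟩ := Φ.isSimpleArc u v h
  refine ⟨γ, fun t => ?_⟩
  have ht : γ t ∈ Φ.arc s(u, v) := hγ ▸ ⟨t, rfl⟩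
  by_cases hp : γ t ∈ Set.range Φ.point
  · obtain ⟨w, hw⟩ := hp
    rw [← hw] at ht ⊢
    rcases Sym2.mem_iff.1 (Φ.mem_of_point_mem_arc w _ h ht) with rfl | rfl
    exacts [point_mem_trace hu, point_mem_trace hv]
  · exact mem_trace_of_mem_arc he ht hp

theorem joinedIn_trace_of_walk (p : G.Walk u v) (hW : ∀ x ∈ p.support, x ∈ W)
    (hE : ∀ e ∈ p.edges, e ∈ E) : JoinedIn (Φ.trace W E) (Φ.point u) (Φ.point v) := by
  induction p with
  | nil => exact JoinedIn.refl (point_mem_trace (hW _ (by simp)))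
  | cons h p ih =>
    refine (joinedIn_trace_of_adj h (hW _ (by simp)) (hW _ (by simp)) (hE _ (by simp))).trans
      (ih (fun x hx => hW x (by simp [hx])) (fun e he => hE e (by simp [he])))

/-- An end of an edge is joined to an inner point of its arc without passing the other end. -/
theorem joinedIn_trace_of_mem_arc (h : G.Adj u v) (hu : u ∈ W) (he : s(u, v) ∈ E) {q : Plane}
    (hq : q ∈ Φ.arc s(u, v)) (hqp : q ∉ Set.range Φ.point) :
    JoinedIn (Φ.trace W E) (Φ.point u) q := by
  obtain ⟨γ, hinj, hγ⟩ := Φ.isSimpleArc u v h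
  obtain ⟨t, rfl⟩ : q ∈ Set.range γ := hγ ▸ hq
  have hpc : IsPathConnected (γ '' Set.Icc 0 t) := by
    have hI : IsPathConnected (Set.Icc (0 : ℝ) t) :=
      (convex_Icc _ _).isPathConnected ⟨0, Set.left_mem_Icc.2 t.2.1⟩
    have := hI.image γ.continuous_extend
    convert this using 1
    ext y
    constructor
    · rintro ⟨s, hs, rfl⟩
      exact ⟨s, ⟨hs.1, hs.2⟩, by simp⟩
    · rintro ⟨s, hs, rfl⟩
      exact ⟨⟨s, hs.1, hs.2.trans t.2.2⟩, ⟨hs.1, hs.2⟩, (γ.extend_apply _).symm⟩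
  refine (hpc.joinedIn _ ⟨0, ⟨le_rfl, t.2.1⟩, γ.source⟩ _ ⟨t, ⟨t.2.1, le_rfl⟩, rfl⟩).mono ?_
  rintro _ ⟨s, hs, rfl⟩
  have hs' : γ s ∈ Φ.arc s(u, v) := hγ ▸ ⟨s, rfl⟩
  by_cases hp : γ s ∈ Set.range Φ.point
  · obtain ⟨w, hw⟩ := hp
    rw [← hw] at hs' ⊢
    rcases Sym2.mem_iff.1 (Φ.mem_of_point_mem_arc w _ h hs') with rfl | rfl
    · exact point_mem_trace hu
    · -- Reaching the far end would force `t = 1`, but `γ t` is no vertex point.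
      have hs1 : s = 1 := hinj (by rw [← hw, γ.target])
      have ht1 : t = 1 := le_antisymm t.2.2 (hs1 ▸ hs.2)
      exact absurd ⟨w, by rw [ht1, γ.target]⟩ hqp
  · exact mem_trace_of_mem_arc he hs' hp

/-! ### Faces and their accessible boundary points -/

theorem isClosed_arc {e : Sym2 V} (he : e ∈ G.edgeSet) : IsClosed (Φ.arc e) := by
  induction e with
  | h u v =>
    obtain ⟨γ, -, hγ⟩ := Φ.isSimpleArc u v he
    rw [← hγ]
    exact (isCompact_range γ.continuous).isClosed

variable (Φ) in
theorem isClosed_drawing [Finite V] : IsClosed Φ.drawing :=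
  (Set.finite_range _).isClosed.union
    ((Set.toFinite G.edgeSet).isClosed_biUnion fun _ he => isClosed_arc he)

namespace IsFace

variable {f : Set Plane}

theorem subset_compl_drawing (hf : Φ.IsFace f) : f ⊆ Φ.drawingᶜ := by
  obtain ⟨x, -, rfl⟩ := hf
  exact connectedComponentIn_subset _ _

theorem isPathConnected [Finite V] (hf : Φ.IsFace f) : IsPathConnected f := by
  obtain ⟨x, hx, rfl⟩ := hf
  exact Φ.isClosed_drawing.isOpen_compl.connectedComponentIn.isConnected_iff_isPathConnected.1
    (isConnected_connectedComponentIn_iff.2 hx)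

theorem subset_of_isPreconnected (hf : Φ.IsFace f) {s : Set Plane} (hs : IsPreconnected s)
    (hsd : s ⊆ Φ.drawingᶜ) {x : Plane} (hxs : x ∈ s) (hxf : x ∈ f) : s ⊆ f := by
  obtain ⟨y, hy, rfl⟩ := hf
  rw [connectedComponentIn_eq hxf]
  exact hs.subset_connectedComponentIn hxs hsd

/-- An edge on the frontier of a face has an inner point accessible from the face: start in the
face close to an inner point `m` of the arc, walk straight towards `m`, and stop at the first
point of the drawing. -/
theorem exists_accessible_point [Finite V] (hf : Φ.IsFace f) (h : G.Adj u v)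
    (hfr : Φ.arc s(u, v) ⊆ frontier f) :
    ∃ q ∈ Φ.arc s(u, v), q ∉ Set.range Φ.point ∧ ∀ z ∈ f, JoinedIn (insert q f) z q := by
  obtain ⟨γ, hinj, hγ⟩ := Φ.isSimpleArc u v h
  let half : unitInterval := ⟨1 / 2, by norm_num, by norm_num⟩
  have hm : γ half ∈ Φ.arc s(u, v) := hγ ▸ ⟨half, rfl⟩
  set m := γ half with hm_def
  have hmp : m ∉ Set.range Φ.point := by
    rintro ⟨w, hw⟩
    have hw' : Φ.point w ∈ Φ.arc s(u, v) := hw ▸ hm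
    rcases Sym2.mem_iff.1 (Φ.mem_of_point_mem_arc w _ h hw') with rfl | rfl
    · have : half = 0 := hinj (by rw [← hm_def, ← hw, γ.source])
      have := congrArg Subtype.val this
      norm_num [half] at this
    · have : half = 1 := hinj (by rw [← hm_def, ← hw, γ.target])
      have := congrArg Subtype.val this
      norm_num [half] at this
  -- Near `m` the drawing consists of inner points of this arc only.
  let K : Set Plane := Set.range Φ.point ∪ ⋃ e ∈ G.edgeSet \ {s(u, v)}, Φ.arc e
  have hK : IsClosed K := (Set.finite_range _).isClosed.union
    ((Set.toFinite _).isClosed_biUnion fun _ he => isClosed_arc he.1)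
  have hmK : m ∉ K := by
    rintro (hp | hx)
    · exact hmp hp
    · obtain ⟨e, he, hxe⟩ := Set.mem_iUnion₂.1 hx
      obtain ⟨w, -, -, hw⟩ := Φ.arc_inter_arc e he.1 _ h he.2 m hxe hm
      exact hmp ⟨w, hw.symm⟩
  have hdK : ∀ x ∈ Φ.drawing, x ∉ K → x ∈ Φ.arc s(u, v) ∧ x ∉ Set.range Φ.point := by
    rintro x (hx | hx) hxK
    · exact absurd (Or.inl hx) hxK
    · obtain ⟨e, he, hxe⟩ := Set.mem_iUnion₂.1 hx
      refine ⟨?_, fun hp => hxK (Or.inl hp)⟩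
      by_cases hee : e = s(u, v)
      · exact hee ▸ hxe
      · exact absurd (Or.inr (Set.mem_iUnion₂.2 ⟨e, ⟨he, hee⟩, hxe⟩)) hxK
  obtain ⟨r, hr, hball⟩ := Metric.isOpen_iff.1 hK.isOpen_compl m hmK
  obtain ⟨x, hxf, hxr⟩ := Metric.mem_closure_iff.1 (frontier_subset_closure (hfr hm)) r hr
  have hxb : x ∈ Metric.ball m r := by rwa [Metric.mem_ball, dist_comm]
  let c : ℝ → Plane := AffineMap.lineMap x m
  have hc : Continuous c := AffineMap.lineMap_continuous
  have hcb : ∀ t ∈ Set.Icc (0 : ℝ) 1, c t ∈ Metric.ball m r := fun t ht =>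
    (convex_ball m r).lineMap_mem hxb (Metric.mem_ball_self hr) ht
  have hmd : m ∈ Φ.drawing := Or.inr (Set.mem_iUnion₂.2 ⟨_, h, hm⟩)
  have hT : IsCompact (Set.Icc (0 : ℝ) 1 ∩ c ⁻¹' Φ.drawing) :=
    isCompact_Icc.inter_right (Φ.isClosed_drawing.preimage hc)
  obtain ⟨t, ⟨ht, htd⟩, hmin⟩ := hT.exists_isLeast
    ⟨1, ⟨zero_le_one, le_rfl⟩, by simpa [c] using hmd⟩
  obtain ⟨hqa, hqp⟩ := hdK (c t) htd (hball (hcb t ht))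
  refine ⟨c t, hqa, hqp, fun z hz => ?_⟩
  have hc0 : c 0 = x := by simp [c]
  have ht0 : 0 < t := by
    refine lt_of_le_of_ne ht.1 fun h0 => ?_
    have : x ∈ Φ.drawing := by rw [← hc0, h0]; exact htd
    exact hf.subset_compl_drawing hxf this
  have hsub : c '' Set.Ico 0 t ⊆ f := by
    refine hf.subset_of_isPreconnected (isPreconnected_Ico.image _ hc.continuousOn) ?_
      ⟨0, ⟨le_rfl, ht0⟩, hc0⟩ hxf
    rintro _ ⟨s, hs, rfl⟩ hsd
    exact (hmin ⟨⟨hs.1, hs.2.le.trans ht.2⟩, hsd⟩).not_gt hs.2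
  have hseg : JoinedIn (insert (c t) f) x (c t) := by
    have hpc : IsPathConnected (c '' Set.Icc 0 t) :=
      ((convex_Icc _ _).isPathConnected ⟨0, Set.left_mem_Icc.2 ht0.le⟩).image hc
    refine (hpc.joinedIn _ ⟨0, ⟨le_rfl, ht0.le⟩, hc0⟩ _ ⟨t, ⟨ht0.le, le_rfl⟩, rfl⟩).mono ?_
    rintro _ ⟨s, hs, rfl⟩
    rcases hs.2.lt_or_eq with hlt | rfl
    · exact Or.inr (hsub ⟨s, ⟨hs.1, hlt⟩, rfl⟩)
    · exact Or.inl rfl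
  exact ((hf.isPathConnected.joinedIn z hz x hxf).mono (Set.subset_insert _ _)).trans hseg

end IsFace

/-- Two disjoint vertex sets `W` and `W'`, each restricted to what one root reaches, are joined by at
most two edges on the frontier of a common face: with the two roots and a point of the face on
one side, and an accessible point of each of three such edges on the other side, a complete
bipartite graph on 3 + 3 vertices would be drawn in the plane. -/
theorem not_three_edges_on_face [Finite V] {f : Set Plane} (hf : Φ.IsFace f)
    (hW : Disjoint W W') (r r' : V) (u v : Fin 3 → V) (hadj : ∀ j, G.Adj (u j) (v j))
    (hinj : Function.Injective fun j => s(u j, v j))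
    (hu : ∀ j, ∃ p : G.Walk r (u j), ∀ x ∈ p.support, x ∈ W)
    (hv : ∀ j, ∃ p : G.Walk r' (v j), ∀ x ∈ p.support, x ∈ W')
    (hfr : ∀ j, Φ.arc s(u j, v j) ⊆ frontier f) : False := by
  choose q hqa hqp hqf using fun j => hf.exists_accessible_point (hadj j) (hfr j)
  obtain ⟨z, hz⟩ := hf.isPathConnected.nonempty
  have huW : ∀ j, u j ∈ W := fun j => by
    obtain ⟨p, hp⟩ := hu j; exact hp _ p.end_mem_support
  have hvW : ∀ j, v j ∈ W' := fun j => by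
    obtain ⟨p, hp⟩ := hv j; exact hp _ p.end_mem_support
  let E : Set V → Fin 3 → Set (Sym2 V) := fun U j =>
    {e | e ∈ G.edgeSet ∧ ((∀ x ∈ e, x ∈ U) ∨ e = s(u j, v j))}
  have hE : ∀ U j, E U j ⊆ G.edgeSet := fun _ _ _ he => he.1
  have hEj : ∀ U j, s(u j, v j) ∈ E U j := fun U j => ⟨hadj j, Or.inr rfl⟩
  have hEW : ∀ j l, s(u j, v j) ∈ E W l → j = l := fun j l ⟨_, h⟩ => by
    rcases h with h | h
    · exact absurd (hvW j) (Set.disjoint_left.1 hW (h _ (Sym2.mem_mk_right _ _)))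
    · exact hinj h
  have hEW' : ∀ j l, s(u j, v j) ∈ E W' l → j = l := fun j l ⟨_, h⟩ => by
    rcases h with h | h
    · exact absurd (h _ (Sym2.mem_mk_left _ _)) (Set.disjoint_left.1 hW (huW j))
    · exact hinj h
  have hEE : ∀ j l, j ≠ l → Disjoint (E W j) (E W' l) := fun j l hjl => by
    rw [Set.disjoint_left]
    rintro e he he'
    rcases he.2 with h | rfl
    · rcases he'.2 with h' | rfl
      · induction e with
        | h x y => exact Set.disjoint_left.1 hW (h x (Sym2.mem_mk_left _ _))
                    (h' x (Sym2.mem_mk_left _ _))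
      · exact hjl (hEW l j he).symm
    · exact hjl (hEW' j l he')
  have hEwalk : ∀ {U : Set V} {x y : V} (p : G.Walk x y) (j : Fin 3),
      (∀ w ∈ p.support, w ∈ U) → ∀ e ∈ p.edges, e ∈ E U j := fun {U x y} p j hp e he =>
    ⟨p.edges_subset_edgeSet he, Or.inl fun w hw => hp w (by
      induction e with
      | h a b =>
        rcases Sym2.mem_iff.1 hw with rfl | rfl
        exacts [p.fst_mem_support_of_mem_edges he, p.snd_mem_support_of_mem_edges he])⟩
  have htr : ∀ j l, j ≠ l → Disjoint (Φ.trace W (E W j)) (Φ.trace W' (E W' l)) :=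
    fun j l hjl => disjoint_trace (hE _ _) (hE _ _) hW (hEE j l hjl)
  have hface : ∀ U : Set V, (∀ j l, s(u j, v j) ∈ E U l → j = l) → ∀ j l, j ≠ l →
      Disjoint (insert (q j) f) (Φ.trace U (E U l)) := fun U hU j l hjl => by
    rw [Set.disjoint_left]
    rintro x (rfl | hx) hxt
    · rcases hxt with ⟨w, -, hw⟩ | hxt
      · exact hqp j ⟨w, hw⟩
      · obtain ⟨e, he, hxe, -⟩ := Set.mem_iUnion₂.1 hxt
        by_cases hej : s(u j, v j) = e
        · exact hjl (hU j l (hej ▸ he))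
        · obtain ⟨w, -, -, hw⟩ := Φ.arc_inter_arc _ (hadj j) e he.1 hej _ (hqa j) hxe
          exact hqp j ⟨w, hw.symm⟩
    · exact hf.subset_compl_drawing hx (trace_subset_drawing (hE _ _) hxt)
  refine no_planar_K33_of_joinedIn ![Φ.point r, Φ.point r', z] q
    ![fun j => Φ.trace W (E W j), fun j => Φ.trace W' (E W' j), fun j => insert (q j) f] ?_ ?_
  · intro i j
    fin_cases i
    · obtain ⟨p, hp⟩ := hu j
      exact (joinedIn_trace_of_walk p hp (hEwalk p j hp)).trans
        (joinedIn_trace_of_mem_arc (hadj j) (huW j) (hEj _ j) (hqa j) (hqp j))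
    · obtain ⟨p, hp⟩ := hv j
      refine (joinedIn_trace_of_walk p hp (hEwalk p j hp)).trans
        (joinedIn_trace_of_mem_arc (hadj j).symm (hvW j) ?_ ?_ (hqp j))
      · rw [Sym2.eq_swap]; exact hEj _ j
      · rw [Sym2.eq_swap]; exact hqa j
    · exact hqf j z hz
  · intro i j k l hik hjl
    fin_cases i <;> fin_cases k
    · exact absurd rfl hik
    · exact htr j l hjl
    · exact (hface W hEW l j hjl.symm).symm
    · exact (htr l j hjl.symm).symm
    · exact absurd rfl hik
    · exact (hface W' hEW' l j hjl.symm).symm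
    · exact hface W hEW j l hjl
    · exact hface W' hEW' j l hjl
    · exact absurd rfl hik

end PlanarEmbedding

/-! ### Weighted distances and Voronoi cells -/

section Cells

variable {V : Type*} {G : SimpleGraph V} {ω : Sym2 V → ℝ≥0∞}

theorem walkWeight_append {u v w : V} (p : G.Walk u v) (q : G.Walk v w) :
    walkWeight ω (p.append q) = walkWeight ω p + walkWeight ω q := by
  simp [walkWeight]

theorem walkWeight_reverse {u v : V} (p : G.Walk u v) :
    walkWeight ω p.reverse = walkWeight ω p := by
  simp [walkWeight]

theorem weightedDist_le_walkWeight {u v : V} (p : G.Walk u v) :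
    weightedDist G ω u v ≤ walkWeight ω p := iInf_le _ p

theorem weightedDist_le_add_walkWeight {u v w : V} (p : G.Walk v w) :
    weightedDist G ω u w ≤ weightedDist G ω u v + walkWeight ω p := by
  rw [weightedDist.eq_1 G ω u v, ENNReal.iInf_add]
  refine le_iInf fun q => ?_
  rw [← walkWeight_append]
  exact weightedDist_le_walkWeight _

theorem exists_walkWeight_eq_weightedDist [Finite V] {u v : V} (h : weightedDist G ω u v ≠ ∞) :
    ∃ p : G.Walk u v, walkWeight ω p = weightedDist G ω u v := by
  classical
  have := Fintype.ofFinite V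
  obtain ⟨p⟩ : Nonempty (G.Walk u v) := by
    by_contra hne
    rw [not_nonempty_iff] at hne
    exact h (by simp [weightedDist])
  have : Nonempty (G.Path u v) := ⟨p.toPath⟩
  obtain ⟨q, hq⟩ := Finite.exists_min fun q : G.Path u v => walkWeight ω q.1
  refine ⟨q.1, le_antisymm (le_iInf fun p => (hq p.toPath).trans ?_)
    (weightedDist_le_walkWeight _)⟩
  exact (p.edges_bypass_sublist_edges.map ω).sum_le_sum fun _ _ => zero_le

/-- Finiteness of the distance from `s` spreads along a walk of finite weight. -/
theorem weightedDist_ne_top_of_mem_support {a b s x y : V} {p : G.Walk a b}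
    (hp : walkWeight ω p ≠ ∞) (hx : x ∈ p.support) (hy : y ∈ p.support)
    (h : weightedDist G ω s x ≠ ∞) : weightedDist G ω s y ≠ ∞ := by
  classical
  have hfin : ∀ z (hz : z ∈ p.support), walkWeight ω (p.takeUntil z hz) ≠ ∞ := fun z hz => by
    rw [← p.take_spec hz, walkWeight_append] at hp
    exact (ENNReal.add_ne_top.1 hp).1
  refine ne_top_of_le_ne_top (ENNReal.add_ne_top.2 ⟨h, ?_⟩)
    (weightedDist_le_add_walkWeight ((p.takeUntil x hx).reverse.append (p.takeUntil y hy)))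
  rw [walkWeight_append, walkWeight_reverse]
  exact ENNReal.add_ne_top.2 ⟨hfin x hx, hfin y hy⟩

variable [LinearOrder V] {S : Finset V} {hS : S.Nonempty}

theorem nearestSite_mem_nearestSites (v : V) :
    nearestSite G ω S hS v ∈ nearestSites G ω S v := Finset.min'_mem _ _

theorem nearestSite_mem (v : V) : nearestSite G ω S hS v ∈ S :=
  (Finset.mem_filter.1 (nearestSite_mem_nearestSites v)).1

theorem weightedDist_nearestSite_le (v : V) {t : V} (ht : t ∈ S) :
    weightedDist G ω (nearestSite G ω S hS v) v ≤ weightedDist G ω t v :=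
  (Finset.mem_filter.1 (nearestSite_mem_nearestSites v)).2 t ht

theorem nearestSite_le {s v : V} (hs : s ∈ S)
    (h : weightedDist G ω s v ≤ weightedDist G ω (nearestSite G ω S hS v) v) :
    nearestSite G ω S hS v ≤ s :=
  Finset.min'_le _ _ (Finset.mem_filter.2
    ⟨hs, fun _ ht => h.trans (weightedDist_nearestSite_le v ht)⟩)

/-- Voronoi cells are star-shaped: a shortest path from the nearest site of `v` to `v` stays in
the cell of that site. The tie-breaking by a fixed linear order is consistent along the path. -/
theorem exists_walk_in_cell [Finite V] {v : V}
    (h : weightedDist G ω (nearestSite G ω S hS v) v ≠ ∞) :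
    ∃ p : G.Walk (nearestSite G ω S hS v) v,
      ∀ x ∈ p.support, nearestSite G ω S hS x = nearestSite G ω S hS v := by
  obtain ⟨p, hp⟩ := exists_walkWeight_eq_weightedDist h
  refine ⟨p, fun x hx => ?_⟩
  set s := nearestSite G ω S hS v with hs
  set c := nearestSite G ω S hS x with hc
  obtain ⟨q, r, rfl⟩ := SimpleGraph.Walk.mem_support_iff_exists_append.1 hx
  rw [walkWeight_append] at hp
  have hr : walkWeight ω r ≠ ∞ := (ENNReal.add_ne_top.1 (hp ▸ h)).2
  have hcx : weightedDist G ω c x ≤ weightedDist G ω s x :=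
    weightedDist_nearestSite_le x (nearestSite_mem v)
  have hsx : weightedDist G ω s x ≤ walkWeight ω q := weightedDist_le_walkWeight q
  have hcv : weightedDist G ω c v ≤ weightedDist G ω c x + walkWeight ω r :=
    weightedDist_le_add_walkWeight r
  have hsv : weightedDist G ω s v ≤ weightedDist G ω c v :=
    weightedDist_nearestSite_le v (nearestSite_mem x)
  refine le_antisymm (nearestSite_le (nearestSite_mem v) ?_)
    (nearestSite_le (nearestSite_mem x) ?_)
  · have : walkWeight ω q + walkWeight ω r ≤ weightedDist G ω c x + walkWeight ω r := by
      rw [hp]; exact hsv.trans hcv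
    exact hsx.trans ((ENNReal.add_le_add_iff_right hr).1 this)
  · rw [← hs, ← hp]
    exact hcv.trans (add_le_add_left (hcx.trans hsx) _)

/-- If the labels of two vertices of a walk of finite weight differ, then every vertex of the walk
has finite distance to its nearest site: otherwise no site would reach the walk at all, and every
vertex of it would be labelled by the least site. -/
theorem weightedDist_nearestSite_ne_top {a b x y z : V} {p : G.Walk a b}
    (hp : walkWeight ω p ≠ ∞) (hx : x ∈ p.support) (hy : y ∈ p.support) (hz : z ∈ p.support)
    (hne : nearestSite G ω S hS x ≠ nearestSite G ω S hS y) :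
    weightedDist G ω (nearestSite G ω S hS z) z ≠ ∞ := by
  intro hinf
  have htop : ∀ w ∈ p.support, ∀ s ∈ S, weightedDist G ω s w = ∞ := fun w hw s hs => by
    by_contra hfin
    exact weightedDist_ne_top_of_mem_support hp hw hz hfin
      (top_le_iff.1 (hinf ▸ weightedDist_nearestSite_le z hs))
  have hle : ∀ w ∈ p.support, ∀ s ∈ S, nearestSite G ω S hS w ≤ s := fun w hw s hs =>
    nearestSite_le hs (by rw [htop w hw s hs, htop w hw _ (nearestSite_mem w)])
  exact hne (le_antisymm (hle x hx _ (nearestSite_mem y)) (hle y hy _ (nearestSite_mem x)))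

end Cells

/-! ### Alternations along the path -/

section Alternations

variable {V : Type*} {G : SimpleGraph V}

/-- If every change of a sequence leads to a value that is new or away from a value that does not
return, then each value accounts for at most two changes. -/
theorem card_changes_le_of_first_or_last [DecidableEq V] (ℓ : ℕ → V) (n : ℕ) (S : Finset V)
    (hS : ∀ i, ℓ i ∈ S)
    (h : ∀ i < n, ℓ i ≠ ℓ (i + 1) → ∀ j < i, ℓ j = ℓ (i + 1) →
      ∀ k, i + 1 < k → k ≤ n → ℓ k ≠ ℓ i) :
    ((Finset.range n).filter fun i => ℓ i ≠ ℓ (i + 1)).card ≤ 2 * S.card := by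
  classical
  let F := (Finset.range n).filter fun i => ∀ j ≤ i, ℓ j ≠ ℓ (i + 1)
  let L := (Finset.range n).filter fun i => ∀ k, i < k → k ≤ n → ℓ k ≠ ℓ i
  have hsub : ((Finset.range n).filter fun i => ℓ i ≠ ℓ (i + 1)) ⊆ F ∪ L := by
    intro i hi
    obtain ⟨hin, hne⟩ := Finset.mem_filter.1 hi
    by_contra hFL
    simp only [F, L, Finset.mem_union, Finset.mem_filter, hin, true_and, not_or, not_forall,
      not_not] at hFL
    obtain ⟨⟨j, hj, hjeq⟩, k, hik, hkn, hkeq⟩ := hFL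
    have hji : j ≠ i := fun e => hne (e ▸ hjeq)
    have hki : k ≠ i + 1 := fun e => hne (e ▸ hkeq).symm
    exact h i (Finset.mem_range.1 hin) hne j (by omega) hjeq k (by omega) hkn hkeq
  have hF : F.card ≤ S.card := by
    refine Finset.card_le_card_of_injOn (fun i => ℓ (i + 1)) (fun i _ => hS _) ?_
    intro i hi i' hi' heq
    have h1 := (Finset.mem_filter.1 hi).2
    have h2 := (Finset.mem_filter.1 hi').2
    rcases lt_trichotomy i i' with hlt | rfl | hlt
    · exact absurd heq (h2 (i + 1) hlt)
    · rfl
    · exact absurd heq.symm (h1 (i' + 1) hlt)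
  have hL : L.card ≤ S.card := by
    refine Finset.card_le_card_of_injOn ℓ (fun i _ => hS _) ?_
    intro i hi i' hi' heq
    obtain ⟨hr, h1⟩ := Finset.mem_filter.1 hi
    obtain ⟨hr', h2⟩ := Finset.mem_filter.1 hi'
    rcases lt_trichotomy i i' with hlt | rfl | hlt
    · exact absurd heq.symm (h1 i' hlt (Finset.mem_range.1 hr').le)
    · rfl
    · exact absurd heq (h2 i hlt (Finset.mem_range.1 hr).le)
  have := (Finset.card_le_card hsub).trans (Finset.card_union_le F L)
  omega

theorem exists_last_index {P : ℕ → Prop} {j i : ℕ} (hji : j ≤ i) (hj : P j) (hi : ¬P i) :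
    ∃ m, j ≤ m ∧ m < i ∧ P m ∧ ∀ l, m < l → l ≤ i → ¬P l := by
  classical
  have hP := Nat.findGreatest_spec hji hj
  exact ⟨Nat.findGreatest P i, Nat.le_findGreatest hji hj,
    lt_of_le_of_ne (Nat.findGreatest_le i) (fun e => hi (e ▸ hP)), hP,
    fun l hl hli => Nat.findGreatest_is_greatest hl hli⟩

/-- A walk inside `W` to a vertex of `p` can be continued backwards along `p` inside `W`. -/
theorem exists_walk_to_earlier {a b r : V} (p : G.Walk a b) {W : Set V} {m i : ℕ} (hmi : m ≤ i)
    (hi : i ≤ p.length) (hr : ∃ q : G.Walk r (p.getVert i), ∀ x ∈ q.support, x ∈ W)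
    (hW : ∀ l, m ≤ l → l ≤ i → p.getVert l ∈ W) :
    ∃ q : G.Walk r (p.getVert m), ∀ x ∈ q.support, x ∈ W := by
  obtain ⟨d, rfl⟩ := Nat.exists_eq_add_of_le hmi
  clear hmi
  induction d with
  | zero => exact hr
  | succ d ih =>
    refine ih (by omega) ?_ (fun l hl hl' => hW l hl (by omega))
    obtain ⟨q, hq⟩ := hr
    have hadj : G.Adj (p.getVert (m + (d + 1))) (p.getVert (m + d)) :=
      (p.adj_getVert_succ (i := m + d) (by omega)).symm
    refine ⟨q.concat hadj, fun x hx => ?_⟩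
    rw [SimpleGraph.Walk.support_concat, List.mem_append, List.mem_singleton] at hx
    rcases hx with hx | rfl
    · exact hq x hx
    · exact hW _ (by omega) (by omega)

theorem SimpleGraph.Walk.IsPath.edge_getVert_inj {a b : V} {p : G.Walk a b} (hp : p.IsPath)
    {m l : ℕ} (hm : m < p.length) (hl : l < p.length)
    (h : s(p.getVert m, p.getVert (m + 1)) = s(p.getVert l, p.getVert (l + 1))) : m = l := by
  rcases Sym2.eq_iff.1 h with ⟨h1, -⟩ | ⟨h1, h2⟩
  · exact hp.getVert_injOn hm.le hl.le h1
  · have e1 := hp.getVert_injOn (show m ≤ p.length from hm.le) (show l + 1 ≤ p.length from hl) h1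
    have e2 := hp.getVert_injOn (show m + 1 ≤ p.length from hm) (show l ≤ p.length from hl.le) h2
    omega

variable {ω : Sym2 V → ℝ≥0∞} [LinearOrder V] {S : Finset V} {hS : S.Nonempty}

/-- Along the path the labels do not read `s, …, t, s, …, t` with adjacent middle entries. Otherwise
three edges of the path lead from the cell of `s` to its complement: the one in the middle, and the
ones by which the path leaves the cell for the last time before the middle and before the final
`t`. Outside the cell of `s`, their other ends are all connected to `t`. -/
theorem labels_not_alternating [Finite V] {Φ : PlanarEmbedding G} {a b : V} {p : G.Walk a b}
    {f : Set Plane} (hp : p.IsPath) (hfin : walkWeight ω p ≠ ∞) (hf : Φ.IsFace f)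
    (hfr : Φ.walkImage p ⊆ frontier f) {i j k : ℕ} (hi : i < p.length)
    (hne : nearestSite G ω S hS (p.getVert i) ≠ nearestSite G ω S hS (p.getVert (i + 1)))
    (hj : j < i)
    (hjeq : nearestSite G ω S hS (p.getVert j) = nearestSite G ω S hS (p.getVert (i + 1)))
    (hik : i + 1 < k) (hk : k ≤ p.length)
    (hkeq : nearestSite G ω S hS (p.getVert k) = nearestSite G ω S hS (p.getVert i)) : False := by
  set s := nearestSite G ω S hS (p.getVert (i + 1)) with hs
  set t := nearestSite G ω S hS (p.getVert i) with ht
  let W : Set V := {x | nearestSite G ω S hS x = s}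
  have hcell : ∀ n, ∃ q : G.Walk (nearestSite G ω S hS (p.getVert n)) (p.getVert n),
      ∀ x ∈ q.support, nearestSite G ω S hS x = nearestSite G ω S hS (p.getVert n) := fun n =>
    exists_walk_in_cell (weightedDist_nearestSite_ne_top hfin (p.getVert_mem_support i)
      (p.getVert_mem_support (i + 1)) (p.getVert_mem_support n) hne)
  have hin : ∀ n, nearestSite G ω S hS (p.getVert n) = s →
      ∃ q : G.Walk s (p.getVert n), ∀ x ∈ q.support, x ∈ W := fun n hn => by
    rw [← hn]
    obtain ⟨q, hq⟩ := hcell n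
    exact ⟨q, fun x hx => (hq x hx).trans hn⟩
  have hout : ∀ n, nearestSite G ω S hS (p.getVert n) = t →
      ∃ q : G.Walk t (p.getVert n), ∀ x ∈ q.support, x ∈ Wᶜ := fun n hn => by
    rw [← hn]
    obtain ⟨q, hq⟩ := hcell n
    exact ⟨q, fun x hx hxs => hne ((hq x hx).trans hn ▸ hxs)⟩
  obtain ⟨j', -, hj'i, hj's, hj'⟩ :=
    exists_last_index (P := fun n => p.getVert n ∈ W) hj.le hjeq hne
  obtain ⟨k', hk'i, hk'k, hk's, hk'⟩ :=
    exists_last_index (P := fun n => p.getVert n ∈ W) hik.le rfl (fun h => hne (hkeq ▸ h))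
  have hout1 := exists_walk_to_earlier p (m := j' + 1) hj'i hi.le (hout i rfl) hj'
  have hout2 := exists_walk_to_earlier p (m := k' + 1) hk'k hk (hout k hkeq) hk'
  let e : Fin 3 → ℕ := ![j', i, k']
  let u : Fin 3 → V := ![p.getVert j', p.getVert (i + 1), p.getVert k']
  let v : Fin 3 → V := ![p.getVert (j' + 1), p.getVert i, p.getVert (k' + 1)]
  have he : ∀ c, e c < p.length := by
    intro c
    fin_cases c
    exacts [hj'i.trans hi, hi, hk'k.trans_le hk]
  have huv : ∀ c, s(u c, v c) = s(p.getVert (e c), p.getVert (e c + 1)) := by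
    intro c
    fin_cases c
    exacts [rfl, Sym2.eq_swap, rfl]
  have hmem : ∀ c, s(u c, v c) ∈ p.edges := fun c =>
    (p.mk_mem_edges_iff_exists).2 ⟨e c, he c, (huv c).symm⟩
  refine PlanarEmbedding.not_three_edges_on_face hf (disjoint_compl_right (a := W)) s t u v
    (fun c => p.adj_of_mem_edges (hmem c)) ?_ ?_ ?_ ?_
  · intro c c' h
    have h' : e c = e c' := hp.edge_getVert_inj (he c) (he c') (by rw [← huv, ← huv]; exact h)
    have hlt : j' < i ∧ i < k' := ⟨hj'i, hk'i⟩
    fin_cases c <;> fin_cases c' <;> first | rfl | (exfalso; simp [e] at h'; omega)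
  · intro c
    fin_cases c
    exacts [hin j' hj's, hin (i + 1) rfl, hin k' hk's]
  · intro c
    fin_cases c
    exacts [hout1, hout i rfl, hout2]
  · exact fun c => subset_trans (fun x hx => Or.inr (Set.mem_iUnion₂.2 ⟨_, hmem c, hx⟩)) hfr

theorem alternationNumber_labelSequence {a b : V} (p : G.Walk a b) :
    alternationNumber (labelSequence G ω S hS p.support) =
      ((Finset.range p.length).filter fun i => nearestSite G ω S hS (p.getVert i) ≠
        nearestSite G ω S hS (p.getVert (i + 1))).card := by
  have hget : ∀ i ≤ p.length, (labelSequence G ω S hS p.support)[i]? =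
      some (nearestSite G ω S hS (p.getVert i)) := fun i hi => by
    rw [labelSequence, List.getElem?_map, ← p.getVert_eq_support_getElem? hi, Option.map_some]
  have hlen : (labelSequence G ω S hS p.support).length - 1 = p.length := by
    simp [labelSequence]
  rw [alternationNumber, hlen, Finset.card_filter]
  refine Finset.sum_congr rfl fun i hi => ?_
  have hi' := Finset.mem_range.1 hi
  rw [hget i hi'.le, hget (i + 1) hi']
  simp

end Alternations

theorem mainTheorem5 :
    ∃ C : ℕ, ∀ (V : Type*) [Finite V] [LinearOrder V] (G : SimpleGraph V) (ω : Sym2 V → ℝ≥0∞)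
      (Φ : PlanarEmbedding G) (S : Finset V) (hS : S.Nonempty)
      (a b : V) (p : G.Walk a b) (f : Set Plane),
      IsShortestPath ω p → walkWeight ω p ≠ ∞ →
      Φ.IsFace f → Φ.walkImage p ⊆ frontier f →
      alternationNumber (labelSequence G ω S hS p.support) ≤ C * S.card := by
  refine ⟨2, fun V _ _ G ω Φ S hS a b p f hp hfin hf hfr => ?_⟩
  rw [alternationNumber_labelSequence]
  exact card_changes_le_of_first_or_last (fun i => nearestSite G ω S hS (p.getVert i)) p.length S
    (fun _ => nearestSite_mem _) fun i hi hne j hj hjeq k hik hk hkeq =>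
      labels_not_alternating hp.1 hfin hf hfr hi hne hj hjeq hik hk hkeq
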